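/- Let $G$ be a (simple) graph that is bipartite with finite disjoint sides $L$ (the offline vertices) and $R$ (the online vertices), i.e. every edge of $G$ joins a vertex of $L$ to a vertex of $R$. Let $\omega$ be an arbitrary arrival order of the online vertices, i.e. a list containing every vertex of $R$ exactly once and no other vertex. The algorithm RANKING on input $(G,\omega)$ draws a ranking $\sigma$ of $L$, i.e. a bijection $\sigma : L \to \{0,\dots,|L|-1\}$, uniformly at random, and starts with $M=\emptyset$. It then processes the online vertices in the order $\omega$: when $u$ arrives, if $u$ has a neighbour in $L$ that is not an endpoint of any edge in the current $M$, the edge $\{v,u\}$ is added to $M$, where $v$ is the neighbour of this kind with the smallest position $\sigma(v)$; otherwise $M$ is unchanged. After the last arrival $M$ is returned. A matching of $G$ is a finite set of edges of $G$, no two distinct ones of which share a vertex. Suppose that a maximum-cardinality matching of $G$ has $n$ edges. Then the output $M$ of RANKING is always a matching of $G$, and its expected size satisfies $$\mathbb{E}\,|M| \;\ge\; \Bigl(1-\frac1e\Bigr)\,n .$$ In particular, if $n\ge 1$, then $\mathbb{E}|M|/n \ge 1-1/e$, i.e. the competitive ratio of RANKING is at least $1-1/e$. -/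

import Mathlib

namespace OnlineMatching

/-- A finite set `M` of edges of `G` is a matching if no two distinct edges in it share a vertex. -/
def IsMatching {V : Type*} (G : SimpleGraph V) (M : Finset (Sym2 V)) : Prop :=
  (∀ e ∈ M, e ∈ G.edgeSet) ∧
    ∀ e ∈ M, ∀ f ∈ M, e ≠ f → ∀ v : V, ¬ (v ∈ e ∧ v ∈ f)

/-- A matching of maximum cardinality among all matchings of `G`. -/
def IsMaximumMatching {V : Type*} (G : SimpleGraph V) (M : Finset (Sym2 V)) : Prop :=
  IsMatching G M ∧ ∀ M' : Finset (Sym2 V), IsMatching G M' → M'.card ≤ M.card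

/-- `v` is an endpoint of some edge in `M`. -/
def Covered {V : Type*} (M : Finset (Sym2 V)) (v : V) : Prop :=
  ∃ e ∈ M, v ∈ e

open Classical in
/-- The neighbours of `u` in the offline side `L` that are not yet matched by `M`. -/
noncomputable def freeNeighbours {V : Type*} (G : SimpleGraph V) (L : Finset V)
    (M : Finset (Sym2 V)) (u : V) : Finset {v : V // v ∈ L} :=
  Finset.univ.filter fun v => G.Adj u v ∧ ¬ Covered M (v : V)

open Classical in
/-- Processing the arrival of `u`: if `u` has an unmatched offline neighbour, then `u` is matched
to the one whose position `σ v` is smallest; otherwise nothing changes. Here `σ` is a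
ranking of the offline vertices, i.e. a bijection onto the positions `0, …, |L| - 1`. -/
noncomputable def rankingStep {V : Type*} (G : SimpleGraph V) (L : Finset V)
    (σ : {v : V // v ∈ L} ≃ Fin L.card) (M : Finset (Sym2 V)) (u : V) : Finset (Sym2 V) :=
  if h : (freeNeighbours G L M u).Nonempty then
    insert s((((freeNeighbours G L M u).exists_min_image σ h).choose : V), u) M
  else M

/-- The matching computed for a fixed ranking `σ` when the online vertices arrive in the
order of the list `ω`. -/
noncomputable def rankingRun {V : Type*} (G : SimpleGraph V) (L : Finset V)
    (σ : {v : V // v ∈ L} ≃ Fin L.card) (ω : List V) : Finset (Sym2 V) :=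
  ω.foldl (rankingStep G L σ) ∅

instance nonempty_rankings {V : Type*} (L : Finset V) : Nonempty ({v : V // v ∈ L} ≃ Fin L.card) :=
  ⟨L.equivFin⟩

open Classical in
/-- RANKING: the distribution of the computed matching when the ranking of the offline
vertices is drawn uniformly at random. -/
noncomputable def ranking {V : Type*} (G : SimpleGraph V) (L : Finset V) (ω : List V) :
    PMF (Finset (Sym2 V)) :=
  (PMF.uniformOfFintype ({v : V // v ∈ L} ≃ Fin L.card)).map fun σ => rankingRun G L σ ω

/-- The expected number of edges of a random edge set with distribution `p`. -/
noncomputable def expectedSize {V : Type*} (p : PMF (Finset (Sym2 V))) : ℝ :=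
  ∑' M : Finset (Sym2 V), (p M).toReal * (M.card : ℝ)

end OnlineMatching

namespace OnlineMatching

/-! Give the offline vertices independent uniform ranks `r` in {0, …, N-1}, ties broken by a uniform
bijection `e`; the induced ranking is uniform (`sum_tieBreak`). Fix a matching with edges a_i b_i, i
= 1, …, n. If a_i is unmatched once its rank is moved to t, then in the original run b_i has a
partner of rank at most t (`exists_partner_tieBreak`). All these partners live in one matching, so
they are distinct (`card_unmatched_update_le`).

For fixed `e`, let x_t count the pairs of a rank function and a matched offline vertex of rank t.
Averaging over `r` gives n N^|L| ≤ N x_t + (x_0 + … + x_t) (`matchedAt_recursion`), and solving this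
recursion gives ∑ x_t ≥ n N^|L| (1 - (1 + 1/N)^(-N)). Average over `e` and let N → ∞. -/

theorem covered_insert {V : Type*} [DecidableEq V] (M : Finset (Sym2 V)) (c u a : V) :
    Covered (insert s(c, u) M) a ↔ (a = c ∨ a = u) ∨ Covered M a := by
  simp [Covered]

theorem Covered.mono {V : Type*} {M M' : Finset (Sym2 V)} (h : M ⊆ M') {v : V}
    (hv : Covered M v) : Covered M' v := by
  obtain ⟨e, he, hve⟩ := hv
  exact ⟨e, h he, hve⟩

theorem mem_freeNeighbours {V : Type*} {G : SimpleGraph V} {L : Finset V}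
    {M : Finset (Sym2 V)} {u : V} {v : {v : V // v ∈ L}} :
    v ∈ freeNeighbours G L M u ↔ G.Adj u v ∧ ¬ Covered M (v : V) := by
  simp [freeNeighbours]

open Classical in
theorem rankingStep_of_nonempty {V : Type*} (G : SimpleGraph V) (L : Finset V)
    (σ : {v : V // v ∈ L} ≃ Fin L.card) (M : Finset (Sym2 V)) (u : V)
    (h : (freeNeighbours G L M u).Nonempty) :
    ∃ c ∈ freeNeighbours G L M u, (∀ b ∈ freeNeighbours G L M u, σ c ≤ σ b) ∧
      rankingStep G L σ M u = insert s((c : V), u) M := by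
  have hc := ((freeNeighbours G L M u).exists_min_image σ h).choose_spec
  refine ⟨_, hc.1, hc.2, ?_⟩
  simp only [rankingStep, dif_pos h]

theorem rankingStep_of_empty {V : Type*} (G : SimpleGraph V) (L : Finset V)
    (σ : {v : V // v ∈ L} ≃ Fin L.card) (M : Finset (Sym2 V)) (u : V)
    (h : ¬ (freeNeighbours G L M u).Nonempty) : rankingStep G L σ M u = M := by
  simp only [rankingStep, dif_neg h]

theorem subset_rankingStep {V : Type*} (G : SimpleGraph V) (L : Finset V)
    (σ : {v : V // v ∈ L} ≃ Fin L.card) (M : Finset (Sym2 V)) (u : V) :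
    M ⊆ rankingStep G L σ M u := by
  classical
  by_cases h : (freeNeighbours G L M u).Nonempty
  · obtain ⟨c, -, -, hc⟩ := rankingStep_of_nonempty G L σ M u h
    rw [hc]
    exact Finset.subset_insert _ _
  · rw [rankingStep_of_empty G L σ M u h]

theorem subset_foldl_rankingStep {V : Type*} (G : SimpleGraph V) (L : Finset V)
    (σ : {v : V // v ∈ L} ≃ Fin L.card) (ω : List V) (M : Finset (Sym2 V)) :
    M ⊆ ω.foldl (rankingStep G L σ) M := by
  induction ω generalizing M with
  | nil => exact Finset.Subset.refl _
  | cons u ω ih => exact (subset_rankingStep G L σ M u).trans (ih _)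

theorem isMatching_foldl_rankingStep {V : Type*} (G : SimpleGraph V) (L : Finset V)
    (σ : {v : V // v ∈ L} ≃ Fin L.card) (ω : List V) (hω : ω.Nodup) (hL : ∀ u ∈ ω, u ∉ L)
    (M : Finset (Sym2 V)) (hM : IsMatching G M) (hfree : ∀ u ∈ ω, ¬ Covered M u) :
    IsMatching G (ω.foldl (rankingStep G L σ) M) := by
  classical
  induction ω generalizing M with
  | nil => exact hM
  | cons u ω ih =>
    rw [List.nodup_cons] at hω
    rw [List.foldl_cons]
    have hLω : ∀ x ∈ ω, x ∉ L := fun x hx => hL x (List.mem_cons_of_mem _ hx)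
    by_cases h : (freeNeighbours G L M u).Nonempty
    · obtain ⟨c, hc, -, hstep⟩ := rankingStep_of_nonempty G L σ M u h
      rw [mem_freeNeighbours] at hc
      have hu : ¬ Covered M u := hfree u (by simp)
      have hnew : ∀ f ∈ M, ∀ v : V, v ∈ s((c : V), u) → v ∉ f := by
        intro f hf v hv hvf
        rcases Sym2.mem_iff.1 hv with rfl | rfl
        · exact hc.2 ⟨f, hf, hvf⟩
        · exact hu ⟨f, hf, hvf⟩
      rw [hstep]
      refine ih hω.2 hLω _ ⟨?_, ?_⟩ ?_
      · intro e he
        rcases Finset.mem_insert.1 he with rfl | he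
        · exact hc.1.symm
        · exact hM.1 e he
      · intro e he f hf hef v hv
        rcases Finset.mem_insert.1 he with rfl | he <;>
          rcases Finset.mem_insert.1 hf with rfl | hf
        · exact hef rfl
        · exact hnew f hf v hv.1 hv.2
        · exact hnew e he v hv.2 hv.1
        · exact hM.2 e he f hf hef v hv
      · intro x hx hcov
        rcases (covered_insert M c u x).1 hcov with (rfl | rfl) | hcov
        · exact hLω _ hx c.2
        · exact hω.1 hx
        · exact hfree x (List.mem_cons_of_mem _ hx) hcov
    · rw [rankingStep_of_empty G L σ M u h]
      exact ih hω.2 hLω M hM fun x hx => hfree x (List.mem_cons_of_mem _ hx)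

theorem isMatching_rankingRun {V : Type*} (G : SimpleGraph V) (L : Finset V)
    (σ : {v : V // v ∈ L} ≃ Fin L.card) (ω : List V) (hω : ω.Nodup) (hL : ∀ u ∈ ω, u ∉ L) :
    IsMatching G (rankingRun G L σ ω) :=
  isMatching_foldl_rankingStep G L σ ω hω hL ∅ ⟨by simp, by simp⟩ (by simp [Covered])

/-! ### Moving a single offline vertex -/

/-- Two rankings agree up to the position of `v`. -/
def AgreeOff {V : Type*} {L : Finset V} (v : {v : V // v ∈ L})
    (σ σ' : {v : V // v ∈ L} ≃ Fin L.card) : Prop :=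
  ∀ a b, a ≠ v → b ≠ v → σ a ≤ σ b → σ' a ≤ σ' b

/-- If `v` stays unmatched under `σ'`, then every other vertex that is free under `σ'` is also
free under any ranking which differs from `σ'` only in the position of `v`. -/
theorem not_covered_foldl_of_agreeOff {V : Type*} (G : SimpleGraph V) (L : Finset V)
    {v : {v : V // v ∈ L}} {σ σ' : {v : V // v ∈ L} ≃ Fin L.card} (hσ : AgreeOff v σ σ')
    (ω : List V) (hL : ∀ u ∈ ω, u ∉ L) (M M' : Finset (Sym2 V))
    (hMM' : ∀ a : {v : V // v ∈ L}, a ≠ v → ¬ Covered M' a → ¬ Covered M a)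
    (hv : ¬ Covered (ω.foldl (rankingStep G L σ') M') v) :
    ∀ a : {v : V // v ∈ L}, a ≠ v → ¬ Covered (ω.foldl (rankingStep G L σ') M') a →
      ¬ Covered (ω.foldl (rankingStep G L σ) M) a := by
  classical
  induction ω generalizing M M' with
  | nil => exact hMM'
  | cons u ω ih =>
    rw [List.foldl_cons] at hv
    simp only [List.foldl_cons]
    refine ih (fun x hx => hL x (List.mem_cons_of_mem _ hx)) _ _ ?_ hv
    have hv' : ¬ Covered (rankingStep G L σ' M' u) v :=
      fun h => hv (h.mono (subset_foldl_rankingStep G L σ' ω _))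
    intro a hav ha hcov
    have haM' : ¬ Covered M' a := fun h => ha (h.mono (subset_rankingStep G L σ' M' u))
    have haM := hMM' a hav haM'
    have hau : (a : V) ≠ u := fun h => hL u (by simp) (h ▸ a.2)
    by_cases h : (freeNeighbours G L M u).Nonempty
    · obtain ⟨c, hc, hmin, hstep⟩ := rankingStep_of_nonempty G L σ M u h
      rw [hstep, covered_insert] at hcov
      have hac : a = c := by
        rcases hcov with (h | h) | h
        · exact Subtype.ext h
        · exact absurd h hau
        · exact absurd h haM
      subst hac
      -- The choice c' under `σ'` is not `v`, so it was also available under `σ`, where `a` was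
      -- preferred. Agreement off `v` then forces c' = `a`, although `a` is free under `σ'`.
      have ha' : a ∈ freeNeighbours G L M' u :=
        mem_freeNeighbours.2 ⟨(mem_freeNeighbours.1 hc).1, haM'⟩
      obtain ⟨c', hc', hmin', hstep'⟩ := rankingStep_of_nonempty G L σ' M' u ⟨a, ha'⟩
      rw [hstep', covered_insert] at ha hv'
      push Not at ha hv'
      have hcv : c' ≠ v := fun h => hv'.1.1 (by rw [h])
      have hc'M : c' ∈ freeNeighbours G L M u :=
        mem_freeNeighbours.2 ⟨(mem_freeNeighbours.1 hc').1,
          hMM' c' hcv (mem_freeNeighbours.1 hc').2⟩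
      have h1 := hσ a c' hav hcv (hmin c' hc'M)
      exact ha.1.1 (congrArg _ (σ'.injective (le_antisymm h1 (hmin' a ha'))))
    · rw [rankingStep_of_empty G L σ M u h] at hcov
      exact haM hcov

/-- If `v` stays unmatched under `σ'` and only the position of `v` is changed, then each neighbour
of `v` is matched to a vertex at least as good as some vertex preceding `v` under `σ'`. -/
theorem exists_partner_of_agreeOff {V : Type*} (G : SimpleGraph V) (L : Finset V)
    {v : {v : V // v ∈ L}} {σ σ' : {v : V // v ∈ L} ≃ Fin L.card} (hσ : AgreeOff v σ σ')
    (ω : List V) (hL : ∀ u ∈ ω, u ∉ L) (hv : ¬ Covered (rankingRun G L σ' ω) v)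
    {u : V} (hu : u ∈ ω) (huv : G.Adj u v) :
    ∃ w w' : {v : V // v ∈ L}, s((w : V), u) ∈ rankingRun G L σ ω ∧ σ w ≤ σ w' ∧
      w' ≠ v ∧ σ' w' ≤ σ' v := by
  classical
  obtain ⟨l₁, l₂, rfl⟩ := List.append_of_mem hu
  simp only [rankingRun, List.foldl_append, List.foldl_cons] at hv ⊢
  set M := l₁.foldl (rankingStep G L σ) ∅ with hM
  set M' := l₁.foldl (rankingStep G L σ') ∅ with hM'
  have hstepv : ¬ Covered (rankingStep G L σ' M' u) v :=
    fun h => hv (h.mono (subset_foldl_rankingStep G L σ' l₂ _))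
  have hvM' : ¬ Covered M' v := fun h => hstepv (h.mono (subset_rankingStep G L σ' M' u))
  have hfree := not_covered_foldl_of_agreeOff G L hσ l₁ (fun x hx => hL x (by simp [hx])) ∅ ∅
    (fun _ _ h => h) hvM'
  have hvf : v ∈ freeNeighbours G L M' u := mem_freeNeighbours.2 ⟨huv, hvM'⟩
  obtain ⟨w', hw', hmin', hstep'⟩ := rankingStep_of_nonempty G L σ' M' u ⟨v, hvf⟩
  -- The vertex `v` is free and adjacent to `u`, yet stays unmatched: `u` must take something ranked
  -- before `v`.
  have hw'v : w' ≠ v := by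
    rintro rfl
    exact hstepv (by rw [hstep', covered_insert]; simp)
  have hw'M : w' ∈ freeNeighbours G L M u :=
    mem_freeNeighbours.2 ⟨(mem_freeNeighbours.1 hw').1,
      hfree w' hw'v (mem_freeNeighbours.1 hw').2⟩
  obtain ⟨w, -, hmin, hstep⟩ := rankingStep_of_nonempty G L σ M u ⟨w', hw'M⟩
  refine ⟨w, w', ?_, hmin w' hw'M, hw'v, hmin' v hvf⟩
  exact subset_foldl_rankingStep G L σ l₂ _ (by rw [hstep]; exact Finset.mem_insert_self _ _)

/-! ### Discrete ranks, resampling and the recursion -/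

theorem sort_symm_le_iff {m N : ℕ} (r : Fin m → Fin N) (i j : Fin m) :
    (Tuple.sort r).symm i ≤ (Tuple.sort r).symm j ↔ r i < r j ∨ r i = r j ∧ i ≤ j := by
  rw [← (Tuple.graphEquiv₂ r).le_iff_le, Tuple.graphEquiv₂_apply, Tuple.graphEquiv₂_apply,
    Equiv.apply_symm_apply, Equiv.apply_symm_apply]
  exact Prod.Lex.le_iff

/-- Overwriting coordinate `k` forgets its old value, which has `N` possibilities. This is
conditioning on r k = t, in counting form. -/
theorem card_filter_update {m N : ℕ} (k : Fin m) (t : Fin N) (P : (Fin m → Fin N) → Prop)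
    [DecidablePred P] :
    (Finset.univ.filter fun r => P (Function.update r k t)).card =
      N * (Finset.univ.filter fun r : Fin m → Fin N => r k = t ∧ P r).card := by
  have h : (Finset.univ.filter fun r => P (Function.update r k t)).card =
      ((Finset.univ : Finset (Fin N)) ×ˢ
        (Finset.univ.filter fun r : Fin m → Fin N => r k = t ∧ P r)).card := by
    refine Finset.card_nbij' (fun r => (r k, Function.update r k t))
      (fun p => Function.update p.2 k p.1) ?_ ?_ ?_ ?_
    · intro r hr
      simpa using hr
    · rintro ⟨s, r⟩ hr
      have hr : r k = t ∧ P r := by simpa using hr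
      have hu : Function.update r k t = r := by rw [← hr.1, Function.update_eq_self]
      simpa [hu] using hr.2
    · intro r _
      simp
    · rintro ⟨s, r⟩ hr
      have hr : r k = t ∧ P r := by simpa using hr
      have hu : Function.update r k t = r := by rw [← hr.1, Function.update_eq_self]
      simp [hu]
  rw [h, Finset.card_product, Finset.card_univ, Fintype.card_fin]

/-- With S_k the k-th partial sum, the hypothesis says (C - S_{k+1}) / N ≤ x_k. Hence the deficit C
- S_k shrinks by a factor 1 + 1/N at each step. -/
theorem le_sum_of_recursion (N : ℕ) (C : ℝ) (x : ℕ → ℝ)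
    (h : ∀ t < N, C ≤ N * x t + ∑ s ∈ Finset.range (t + 1), x s) :
    C * (1 - ((1 + 1 / (N : ℝ)) ^ N)⁻¹) ≤ ∑ s ∈ Finset.range N, x s := by
  rcases Nat.eq_zero_or_pos N with rfl | hN
  · simp
  have hN' : (0 : ℝ) < N := by exact_mod_cast hN
  have key : ∀ k ≤ N, (C - ∑ s ∈ Finset.range k, x s) * (1 + 1 / (N : ℝ)) ^ k ≤ C := by
    intro k hk
    induction k with
    | zero => simp
    | succ k ih =>
      refine le_trans ?_ (ih (Nat.le_of_succ_le hk))
      have h1 := h k hk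
      rw [Finset.sum_range_succ] at h1 ⊢
      rw [pow_succ', ← mul_assoc]
      refine mul_le_mul_of_nonneg_right ?_ (by positivity)
      rw [← sub_nonneg] at h1 ⊢
      convert! div_nonneg h1 hN'.le using 1
      field_simp
      ring
  have hpow : (0 : ℝ) < (1 + 1 / (N : ℝ)) ^ N := by positivity
  have h1 := key N le_rfl
  rw [← le_div_iff₀ hpow, div_eq_mul_inv] at h1
  linarith

/-- The ranking that sorts the offline vertices by `r`, breaking ties by `e`. -/
def tieBreak {V : Type*} {L : Finset V} {N : ℕ} (e : {v : V // v ∈ L} ≃ Fin L.card)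
    (r : Fin L.card → Fin N) : {v : V // v ∈ L} ≃ Fin L.card :=
  e.trans (Tuple.sort r).symm

theorem tieBreak_le_iff {V : Type*} {L : Finset V} {N : ℕ} (e : {v : V // v ∈ L} ≃ Fin L.card)
    (r : Fin L.card → Fin N) (a b : {v : V // v ∈ L}) :
    tieBreak e r a ≤ tieBreak e r b ↔ r (e a) < r (e b) ∨ r (e a) = r (e b) ∧ e a ≤ e b :=
  sort_symm_le_iff r (e a) (e b)

theorem le_of_tieBreak_le {V : Type*} {L : Finset V} {N : ℕ} {e : {v : V // v ∈ L} ≃ Fin L.card}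
    {r : Fin L.card → Fin N} {a b : {v : V // v ∈ L}} (h : tieBreak e r a ≤ tieBreak e r b) :
    r (e a) ≤ r (e b) := by
  rcases (tieBreak_le_iff e r a b).1 h with h | h
  · exact h.le
  · exact h.1.le

theorem agreeOff_tieBreak_update {V : Type*} {L : Finset V} {N : ℕ}
    (e : {v : V // v ∈ L} ≃ Fin L.card) (r : Fin L.card → Fin N) (v : {v : V // v ∈ L})
    (t : Fin N) : AgreeOff v (tieBreak e r) (tieBreak e (Function.update r (e v) t)) := by
  intro a b ha hb hab
  rw [tieBreak_le_iff] at hab ⊢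
  rwa [Function.update_of_ne (e.injective.ne ha), Function.update_of_ne (e.injective.ne hb)]

theorem exists_partner_tieBreak {V : Type*} (G : SimpleGraph V) (L : Finset V) {N : ℕ}
    (e : {v : V // v ∈ L} ≃ Fin L.card) (r : Fin L.card → Fin N) (t : Fin N)
    (ω : List V) (hL : ∀ u ∈ ω, u ∉ L) {v : {v : V // v ∈ L}}
    (hv : ¬ Covered (rankingRun G L (tieBreak e (Function.update r (e v) t)) ω) v)
    {u : V} (hu : u ∈ ω) (huv : G.Adj u v) :
    ∃ w : {v : V // v ∈ L}, s((w : V), u) ∈ rankingRun G L (tieBreak e r) ω ∧ r (e w) ≤ t := by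
  obtain ⟨w, w', hw, hww', hw'v, hle⟩ :=
    exists_partner_of_agreeOff G L (agreeOff_tieBreak_update e r v t) ω hL hv hu huv
  refine ⟨w, hw, (le_of_tieBreak_le hww').trans ?_⟩
  have := le_of_tieBreak_le hle
  rwa [Function.update_self, Function.update_of_ne (e.injective.ne hw'v)] at this

/-! ### Counting matched vertices by rank -/

-- Each index `i` moves a different vertex, but all are compared with the same unmoved run. Sending
-- `i` to the partner of `b i` there is injective because that run is a matching.
open Classical in
theorem card_unmatched_update_le {V : Type*} (G : SimpleGraph V) (L : Finset V) {N : ℕ}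
    (e : {v : V // v ∈ L} ≃ Fin L.card) (r : Fin L.card → Fin N) (t : Fin N)
    (ω : List V) (hω : ω.Nodup) (hL : ∀ u ∈ ω, u ∉ L)
    {ι : Type*} [Fintype ι] (a : ι → {v : V // v ∈ L}) (b : ι → V)
    (hb : Function.Injective b) (hbω : ∀ i, b i ∈ ω) (hab : ∀ i, G.Adj (b i) (a i)) :
    (Finset.univ.filter fun i =>
      ¬ Covered (rankingRun G L (tieBreak e (Function.update r (e (a i)) t)) ω) (a i)).card ≤
    (Finset.univ.filter fun w : {v : V // v ∈ L} =>
      r (e w) ≤ t ∧ Covered (rankingRun G L (tieBreak e r) ω) w).card := by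
  have hM := isMatching_rankingRun G L (tieBreak e r) ω hω hL
  rcases isEmpty_or_nonempty ι with hι | ⟨⟨i₀⟩⟩
  · simp
  -- Supplies the junk value that `choose!` needs at indices whose vertex is matched.
  have : Nonempty {v : V // v ∈ L} := ⟨a i₀⟩
  have h : ∀ i, ¬ Covered (rankingRun G L (tieBreak e (Function.update r (e (a i)) t)) ω) (a i) →
      ∃ w : {v : V // v ∈ L}, s((w : V), b i) ∈ rankingRun G L (tieBreak e r) ω ∧
        r (e w) ≤ t :=
    fun i hi => exists_partner_tieBreak G L e r t ω hL hi (hbω i) (hab i)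
  choose! w hw hwt using h
  refine Finset.card_le_card_of_injOn w ?_ ?_
  · intro i hi
    have hi := (Finset.mem_filter.1 hi).2
    exact Finset.mem_filter.2 ⟨Finset.mem_univ _, hwt i hi, _, hw i hi, Sym2.mem_mk_left _ _⟩
  · intro i hi j hj hij
    have hi := hw i (Finset.mem_filter.1 hi).2
    have hj := hw j (Finset.mem_filter.1 hj).2
    rw [← hij] at hj
    by_contra hne
    refine hM.2 _ hi _ hj ?_ (w i : V) ⟨Sym2.mem_mk_left _ _, Sym2.mem_mk_left _ _⟩
    rw [Ne, Sym2.congr_right]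
    exact hb.ne hne

open Classical in
theorem card_covered_le_card {V : Type*} (G : SimpleGraph V) (L R : Finset V)
    (hG : G.IsBipartiteWith (L : Set V) (R : Set V)) (M : Finset (Sym2 V))
    (hM : IsMatching G M) :
    (Finset.univ.filter fun w : {v : V // v ∈ L} => Covered M w).card ≤ M.card := by
  refine Finset.card_le_card_of_forall_subsingleton
    (fun (w : {v : V // v ∈ L}) f => (w : V) ∈ f) ?_ ?_
  · exact fun w hw => (Finset.mem_filter.1 hw).2
  · rintro f hf w ⟨-, hw⟩ w' ⟨-, hw'⟩
    by_contra hne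
    have hfe : f = s((w : V), (w' : V)) :=
      (Sym2.mem_and_mem_iff fun h => hne (Subtype.ext h)).1 ⟨hw, hw'⟩
    have hadj := hM.1 _ hf
    rw [hfe, SimpleGraph.mem_edgeSet] at hadj
    exact Set.disjoint_left.1 hG.disjoint w'.2 (hG.mem_of_mem_adj w.2 hadj)

open Classical in
/-- The number of pairs of a rank function and a matched offline vertex of rank `s`. -/
noncomputable def matchedAt {V : Type*} (G : SimpleGraph V) (L : Finset V) (N : ℕ)
    (e : {v : V // v ∈ L} ≃ Fin L.card) (ω : List V) (s : ℕ) : ℕ :=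
  ∑ w : {v : V // v ∈ L}, (Finset.univ.filter fun r : Fin L.card → Fin N =>
    (r (e w) : ℕ) = s ∧ Covered (rankingRun G L (tieBreak e r) ω) w).card

open Classical in
theorem sum_matchedAt {V : Type*} (G : SimpleGraph V) (L : Finset V) (N : ℕ)
    (e : {v : V // v ∈ L} ≃ Fin L.card) (ω : List V) (k : ℕ) :
    ∑ s ∈ Finset.range k, matchedAt G L N e ω s =
      ∑ r : Fin L.card → Fin N, (Finset.univ.filter fun w : {v : V // v ∈ L} =>
        (r (e w) : ℕ) < k ∧ Covered (rankingRun G L (tieBreak e r) ω) w).card := by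
  simp only [matchedAt, Finset.card_filter]
  rw [Finset.sum_comm, Finset.sum_comm (s := (Finset.univ : Finset (Fin L.card → Fin N)))]
  refine Finset.sum_congr rfl fun w _ => ?_
  rw [Finset.sum_comm]
  refine Finset.sum_congr rfl fun r _ => ?_
  by_cases hc : Covered (rankingRun G L (tieBreak e r) ω) w <;> simp [hc]

/-- Among rank functions giving `a i` rank `t`, the matched cases contribute to `matchedAt` at `t`.
The unmatched ones, times `N`, become a count over all `r` by resampling, bounded pointwise in `r`.
-/
theorem matchedAt_recursion {V : Type*} (G : SimpleGraph V) (L : Finset V) (N : ℕ)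
    (e : {v : V // v ∈ L} ≃ Fin L.card)
    (ω : List V) (hω : ω.Nodup) (hL : ∀ u ∈ ω, u ∉ L)
    {ι : Type*} [Fintype ι] (a : ι → {v : V // v ∈ L}) (b : ι → V)
    (ha : Function.Injective a) (hb : Function.Injective b) (hbω : ∀ i, b i ∈ ω)
    (hab : ∀ i, G.Adj (b i) (a i)) (t : ℕ) (ht : t < N) :
    Fintype.card ι * N ^ L.card ≤
      N * matchedAt G L N e ω t + ∑ s ∈ Finset.range (t + 1), matchedAt G L N e ω s := by
  classical
  set t' : Fin N := ⟨t, ht⟩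
  set A : (Fin L.card → Fin N) → Finset (Sym2 V) :=
    fun r => rankingRun G L (tieBreak e r) ω with hA
  have hall : ∀ i, N ^ L.card = N * (Finset.univ.filter fun r : Fin L.card → Fin N =>
      r (e (a i)) = t').card := by
    intro i
    have := card_filter_update (e (a i)) t' (fun _ => True)
    simpa using this
  have hsplit : ∀ i, (Finset.univ.filter fun r : Fin L.card → Fin N => r (e (a i)) = t').card =
      (Finset.univ.filter fun r : Fin L.card → Fin N =>
        r (e (a i)) = t' ∧ Covered (A r) (a i)).card +
      (Finset.univ.filter fun r : Fin L.card → Fin N =>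
        r (e (a i)) = t' ∧ ¬ Covered (A r) (a i)).card := by
    intro i
    rw [← Finset.card_filter_add_card_filter_not (fun r => Covered (A r) (a i)),
      Finset.filter_filter, Finset.filter_filter]
  have hmatched : ∑ i, (Finset.univ.filter fun r : Fin L.card → Fin N =>
      r (e (a i)) = t' ∧ Covered (A r) (a i)).card ≤ matchedAt G L N e ω t := by
    have h := Finset.sum_le_sum_of_subset (f := fun w : {v : V // v ∈ L} =>
      (Finset.univ.filter fun r : Fin L.card → Fin N =>
        r (e w) = t' ∧ Covered (A r) w).card) (Finset.subset_univ (Finset.univ.image a))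
    rw [Finset.sum_image ha.injOn] at h
    simpa only [matchedAt, Fin.ext_iff] using h
  have hunmatched : N * ∑ i, (Finset.univ.filter fun r : Fin L.card → Fin N =>
      r (e (a i)) = t' ∧ ¬ Covered (A r) (a i)).card ≤
      ∑ s ∈ Finset.range (t + 1), matchedAt G L N e ω s := by
    rw [Finset.mul_sum, sum_matchedAt]
    calc _ = ∑ i, (Finset.univ.filter fun r : Fin L.card → Fin N =>
          ¬ Covered (A (Function.update r (e (a i)) t')) (a i)).card :=
        Finset.sum_congr rfl fun i _ =>
          (card_filter_update (e (a i)) t' fun r => ¬ Covered (A r) (a i)).symm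
      _ = ∑ r : Fin L.card → Fin N, (Finset.univ.filter fun i =>
          ¬ Covered (A (Function.update r (e (a i)) t')) (a i)).card := by
        simp only [Finset.card_filter]
        exact Finset.sum_comm
      _ ≤ _ := Finset.sum_le_sum fun r _ => by
        refine (card_unmatched_update_le G L e r t' ω hω hL a b hb hbω hab).trans_eq ?_
        simp only [Fin.le_def, Nat.lt_succ_iff, t']
  calc Fintype.card ι * N ^ L.card = ∑ i : ι, N ^ L.card := by simp
    _ = N * ∑ i, (Finset.univ.filter fun r : Fin L.card → Fin N =>
          r (e (a i)) = t' ∧ Covered (A r) (a i)).card +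
        N * ∑ i, (Finset.univ.filter fun r : Fin L.card → Fin N =>
          r (e (a i)) = t' ∧ ¬ Covered (A r) (a i)).card := by
      rw [← mul_add, ← Finset.sum_add_distrib, Finset.mul_sum]
      exact Finset.sum_congr rfl fun i _ => by rw [← hsplit, ← hall]
    _ ≤ _ := add_le_add (Nat.mul_le_mul_left _ hmatched) hunmatched

theorem sum_card_tieBreak_ge {V : Type*} (G : SimpleGraph V) (L R : Finset V)
    (hG : G.IsBipartiteWith (L : Set V) (R : Set V)) (N : ℕ)
    (e : {v : V // v ∈ L} ≃ Fin L.card)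
    (ω : List V) (hω : ω.Nodup) (hL : ∀ u ∈ ω, u ∉ L)
    {ι : Type*} [Fintype ι] (a : ι → {v : V // v ∈ L}) (b : ι → V)
    (ha : Function.Injective a) (hb : Function.Injective b) (hbω : ∀ i, b i ∈ ω)
    (hab : ∀ i, G.Adj (b i) (a i)) :
    (Fintype.card ι * (N : ℝ) ^ L.card) * (1 - ((1 + 1 / (N : ℝ)) ^ N)⁻¹) ≤
      ∑ r : Fin L.card → Fin N, ((rankingRun G L (tieBreak e r) ω).card : ℝ) := by
  classical
  refine (le_sum_of_recursion N _ (fun s => (matchedAt G L N e ω s : ℝ)) ?_).trans ?_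
  · intro t ht
    exact_mod_cast matchedAt_recursion G L N e ω hω hL a b ha hb hbω hab t ht
  · rw [← Nat.cast_sum, ← Nat.cast_sum, sum_matchedAt]
    refine Nat.cast_le.2 (Finset.sum_le_sum fun r _ => ?_)
    refine le_trans (Finset.card_le_card fun w hw => ?_)
      (card_covered_le_card G L R hG _ (isMatching_rankingRun G L (tieBreak e r) ω hω hL))
    simp only [Finset.mem_filter] at hw ⊢
    exact ⟨hw.1, hw.2.2⟩

/-! ### Averaging over tie-breaks and the limit -/

/-- For fixed `r`, composing with the sorting permutation is a bijection on rankings, so ties cost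
nothing at any finite `N`. -/
theorem sum_tieBreak {V : Type*} {L : Finset V} (N : ℕ)
    (g : ({v : V // v ∈ L} ≃ Fin L.card) → ℝ) [Fintype ({v : V // v ∈ L} ≃ Fin L.card)] :
    ∑ e, ∑ r : Fin L.card → Fin N, g (tieBreak e r) = (N : ℝ) ^ L.card * ∑ σ, g σ := by
  rw [Finset.sum_comm]
  have : ∀ r : Fin L.card → Fin N, ∑ e, g (tieBreak e r) = ∑ σ, g σ := by
    intro r
    refine Fintype.sum_equiv ⟨fun e => e.trans (Tuple.sort r).symm,
      fun e => e.trans (Tuple.sort r), fun e => ?_, fun e => ?_⟩ _ _ fun e => rfl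
    · ext; simp
    · ext; simp
  simp [this]

theorem expectedSize_map_uniform {V α : Type*} [Fintype α] [Nonempty α]
    (f : α → Finset (Sym2 V)) :
    expectedSize ((PMF.uniformOfFintype α).map f) =
      (∑ x, ((f x).card : ℝ)) / Fintype.card α := by
  classical
  have hp : ∀ M, (((PMF.uniformOfFintype α).map f) M).toReal =
      ∑ x, if M = f x then ((Fintype.card α : ℝ))⁻¹ else 0 := by
    intro M
    rw [PMF.map_apply, tsum_fintype, ENNReal.toReal_sum]
    · refine Finset.sum_congr rfl fun x _ => ?_
      split_ifs <;> simp
    · intro x _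
      split_ifs <;> simp
  rw [expectedSize, tsum_eq_sum (s := Finset.univ.image f)]
  · simp only [hp, Finset.sum_mul]
    rw [Finset.sum_comm, Finset.sum_div]
    refine Finset.sum_congr rfl fun x _ => ?_
    rw [Finset.sum_eq_single (f x)]
    · simp [div_eq_inv_mul]
    · intro M _ hM
      simp [hM]
    · intro h
      exact absurd (Finset.mem_image_of_mem f (Finset.mem_univ x)) h
  · intro M hM
    rw [hp, Finset.sum_eq_zero, zero_mul]
    intro x _
    rw [if_neg]
    rintro rfl
    exact hM (Finset.mem_image_of_mem f (Finset.mem_univ x))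

theorem expectedSize_ranking_ge {V : Type*} (G : SimpleGraph V) (L R : Finset V)
    (hG : G.IsBipartiteWith (L : Set V) (R : Set V))
    (ω : List V) (hω : ω.Nodup) (hL : ∀ u ∈ ω, u ∉ L)
    {ι : Type*} [Fintype ι] (a : ι → {v : V // v ∈ L}) (b : ι → V)
    (ha : Function.Injective a) (hb : Function.Injective b) (hbω : ∀ i, b i ∈ ω)
    (hab : ∀ i, G.Adj (b i) (a i)) (N : ℕ) (hN : 0 < N) :
    Fintype.card ι * (1 - ((1 + 1 / (N : ℝ)) ^ N)⁻¹) ≤ expectedSize (ranking G L ω) := by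
  classical
  rw [ranking, expectedSize_map_uniform, le_div_iff₀ (by exact_mod_cast Fintype.card_pos)]
  have hT : (0 : ℝ) < (N : ℝ) ^ L.card := by positivity
  rw [← mul_le_mul_iff_right₀ hT]
  refine le_trans (le_of_eq ?_) ((Finset.sum_le_sum fun e _ =>
    sum_card_tieBreak_ge G L R hG N e ω hω hL a b ha hb hbω hab).trans_eq
      (sum_tieBreak N fun σ => ((rankingRun G L σ ω).card : ℝ)))
  rw [Finset.sum_const, Finset.card_univ, nsmul_eq_mul]
  ring

theorem tendsto_one_sub_inv_pow :
    Filter.Tendsto (fun N : ℕ => 1 - ((1 + 1 / (N : ℝ)) ^ N)⁻¹) Filter.atTop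
      (nhds (1 - 1 / Real.exp 1)) := by
  rw [one_div]
  exact ((Real.tendsto_one_add_div_pow_exp 1).inv₀ (Real.exp_ne_zero 1)).const_sub 1

theorem exists_ends {V : Type*} (G : SimpleGraph V) (L R : Finset V)
    (hG : G.IsBipartiteWith (L : Set V) (R : Set V)) {e : Sym2 V} (he : e ∈ G.edgeSet) :
    ∃ (a : {v : V // v ∈ L}) (b : V), b ∈ R ∧ G.Adj b a ∧ e = s((a : V), b) := by
  induction e with
  | _ x y =>
    rw [SimpleGraph.mem_edgeSet] at he
    rcases hG.mem_of_adj he with ⟨hx, hy⟩ | ⟨hx, hy⟩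
    · exact ⟨⟨x, hx⟩, y, hy, he.symm, rfl⟩
    · exact ⟨⟨y, hy⟩, x, hx, he, Sym2.eq_swap⟩

end OnlineMatching

/-- The competitive ratio of RANKING is at least `1 - 1/e`: `L` is the offline side, `R` the
online side, and `ω` lists the vertices of `R` in their (arbitrary) order of arrival. -/
theorem mainTheorem1 {V : Type*} (G : SimpleGraph V) (L R : Finset V)
    (hG : G.IsBipartiteWith (L : Set V) (R : Set V))
    (ω : List V) (hω_nodup : ω.Nodup) (hω_mem : ∀ v : V, v ∈ ω ↔ v ∈ R)
    (n : ℕ) (hn : ∃ M : Finset (Sym2 V), OnlineMatching.IsMaximumMatching G M ∧ M.card = n) :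
    (∀ M ∈ (OnlineMatching.ranking G L ω).support, OnlineMatching.IsMatching G M) ∧
      (1 - 1 / Real.exp 1) * (n : ℝ) ≤
        OnlineMatching.expectedSize (OnlineMatching.ranking G L ω) := by
  have hL : ∀ u ∈ ω, u ∉ L := fun u hu huL =>
    Set.disjoint_left.1 hG.disjoint huL ((hω_mem u).1 hu)
  constructor
  · intro M hM
    rw [OnlineMatching.ranking, PMF.mem_support_map_iff] at hM
    obtain ⟨σ, -, rfl⟩ := hM
    exact OnlineMatching.isMatching_rankingRun G L σ ω hω_nodup hL
  · obtain ⟨M, ⟨hM, -⟩, rfl⟩ := hn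
    choose a b hbR hab heq using fun e : {e // e ∈ M} =>
      OnlineMatching.exists_ends G L R hG (hM.1 e e.2)
    have hinj : ∀ (e f : {e // e ∈ M}) (v : V), v ∈ (e : Sym2 V) → v ∈ (f : Sym2 V) → e = f := by
      intro e f v he hf
      by_contra hne
      exact hM.2 e e.2 f f.2 (fun h => hne (Subtype.ext h)) v ⟨he, hf⟩
    have ha : Function.Injective a := fun e f h => hinj e f (a e)
      (by rw [heq e]; exact Sym2.mem_mk_left _ _) (by rw [heq f, h]; exact Sym2.mem_mk_left _ _)
    have hb : Function.Injective b := fun e f h => hinj e f (b e)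
      (by rw [heq e]; exact Sym2.mem_mk_right _ _) (by rw [heq f, h]; exact Sym2.mem_mk_right _ _)
    -- The expected size does not depend on `N`, so the bounds pass to the limit.
    refine le_of_tendsto (OnlineMatching.tendsto_one_sub_inv_pow.mul_const _) ?_
    filter_upwards [Filter.eventually_gt_atTop 0] with N hN
    have := OnlineMatching.expectedSize_ranking_ge G L R hG ω hω_nodup hL a b ha hb
      (fun e => (hω_mem _).2 (hbR e)) hab N hN
    rwa [Fintype.card_coe, mul_comm] at this
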